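/- Graphs are simple, undirected and have at least one vertex. First-order sentences about graphs use the adjacency and equality relations. The variable width of a sentence is the number of distinct variables occurring in it. For a graph $F$, let $W[F]$ be the minimum variable width of a first-order sentence that is true on exactly those graphs that contain an induced subgraph isomorphic to $F$. For graphs $G,H$ let $D^k(G,H)\in\mathbb N\cup\{\infty\}$ be the minimum quantifier depth of a sentence with at most $k$ variables that is true on exactly one of $G$ and $H$ (and $\infty$ if there is none). Let $P_4$ be the path on $4$ vertices. Then: (1) $W[P_4]=4$, both when only finite graphs are considered and when infinite graphs are allowed as well. In particular, no first-order sentence with at most $3$ variables defines, even among finite graphs only, the class of graphs containing an induced $P_4$. (2) Let $H_1=K_1$ and let $H_{i+1}=\overline{H_i+H_i}$ be the complement of the disjoint union of two copies of $H_i$. Every $H_i$, $i\ge1$, is a cograph, i.e. it can be built from copies of $K_1$ by disjoint unions and complementations, and it contains no induced $P_4$. (3) Say that a graph $A$ has the $3$-extension property if for all disjoint sets $X,Y\subseteq V(A)$ with $|X\cup Y|<3$ there is a vertex $z\notin X\cup Y$ adjacent to all vertices in $X$ and to none in $Y$. There is a finite graph $A$ that has the $3$-extension property and contains an induced $P_4$.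 For every graph $A$ (finite or infinite) with these two properties, put $G_i=H_i\cdot(A\cdot H_i)$, where $\cdot$ is the lexicographic product: $V(B\cdot C)=V(B)\times V(C)$, and $(u,v)$, $(x,y)$ are adjacent if $u,x$ are adjacent in $B$, or $u=x$ and $v,y$ are adjacent in $C$. Then every $G_i$, $i\ge 1$, contains an induced $P_4$, and for every integer $m\ge0$ $$D^3(G_{4m+3},H_{4m+3})\ \ge\ m+2 .$$ -/

import Mathlib

universe u v

/-! ### First-order logic of graphs, with named variables `x₀, x₁, x₂, …` -/

/-- First-order formulas in the vocabulary of adjacency and equality. -/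
inductive GraphFormula : Type
  | equal (x y : ℕ) : GraphFormula
  | adj (x y : ℕ) : GraphFormula
  | neg (φ : GraphFormula) : GraphFormula
  | conj (φ ψ : GraphFormula) : GraphFormula
  | disj (φ ψ : GraphFormula) : GraphFormula
  | ex (x : ℕ) (φ : GraphFormula) : GraphFormula
  | all (x : ℕ) (φ : GraphFormula) : GraphFormula

namespace GraphFormula

/-- The set of variables occurring in a formula (free, bound, or next to a quantifier). -/
def vars : GraphFormula → Finset ℕ
  | equal x y => {x, y}
  | adj x y => {x, y}
  | neg φ => φ.vars
  | conj φ ψ => φ.vars ∪ ψ.vars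
  | disj φ ψ => φ.vars ∪ ψ.vars
  | ex x φ => insert x φ.vars
  | all x φ => insert x φ.vars

/-- The set of variables having a free occurrence. -/
def freeVars : GraphFormula → Finset ℕ
  | equal x y => {x, y}
  | adj x y => {x, y}
  | neg φ => φ.freeVars
  | conj φ ψ => φ.freeVars ∪ ψ.freeVars
  | disj φ ψ => φ.freeVars ∪ ψ.freeVars
  | ex x φ => φ.freeVars.erase x
  | all x φ => φ.freeVars.erase x

/-- A sentence is a formula without free variables. -/
def IsSentence (φ : GraphFormula) : Prop := φ.freeVars = ∅

/-- Variable width: the number of distinct variables occurring in the formula. -/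
def width (φ : GraphFormula) : ℕ := φ.vars.card

/-- Quantifier depth. -/
def depth : GraphFormula → ℕ
  | equal _ _ => 0
  | adj _ _ => 0
  | neg φ => φ.depth
  | conj φ ψ => max φ.depth ψ.depth
  | disj φ ψ => max φ.depth ψ.depth
  | ex _ φ => φ.depth + 1
  | all _ φ => φ.depth + 1

/-- Truth of a formula in the graph `G` under the assignment `s` of vertices to variables. -/
def Sat {V : Type u} (G : SimpleGraph V) : (ℕ → V) → GraphFormula → Prop
  | s, equal x y => s x = s y
  | s, adj x y => G.Adj (s x) (s y)
  | s, neg φ => ¬ Sat G s φ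
  | s, conj φ ψ => Sat G s φ ∧ Sat G s ψ
  | s, disj φ ψ => Sat G s φ ∨ Sat G s ψ
  | s, ex x φ => ∃ a : V, Sat G (Function.update s x a) φ
  | s, all x φ => ∀ a : V, Sat G (Function.update s x a) φ

/-- `G ⊨ φ`. It is used only for sentences `φ` and nonempty graphs `G`, where the truth value does
not depend on the assignment. -/
def Models {V : Type u} (G : SimpleGraph V) (φ : GraphFormula) : Prop :=
  ∀ s : ℕ → V, Sat G s φ

/-- `φ` is true on exactly one of `G` and `H`. -/
def Distinguishes {V : Type u} {W : Type v} (φ : GraphFormula)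
    (G : SimpleGraph V) (H : SimpleGraph W) : Prop :=
  (Models G φ ∧ ¬ Models H φ) ∨ (¬ Models G φ ∧ Models H φ)

end GraphFormula

/-- `D^k(G, H)`: the minimum quantifier depth of a sentence with at most `k` variables that
distinguishes `G` and `H`, and `⊤` if there is no such sentence. -/
noncomputable def logicalDepthWith {V : Type u} {W : Type v} (k : ℕ)
    (G : SimpleGraph V) (H : SimpleGraph W) : ℕ∞ :=
  ⨅ φ : {φ : GraphFormula // φ.IsSentence ∧ φ.width ≤ k ∧ φ.Distinguishes G H}, (φ.1.depth : ℕ∞)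

/-! ### Classes of graphs and their logical width -/

/-- A class of graphs. -/
abbrev GraphClass : Type 1 := ∀ V : Type, SimpleGraph V → Prop

/-- The class of all graphs, finite or infinite. -/
def allGraphs : GraphClass := fun _ _ => True

/-- The class of all finite graphs. -/
def finiteGraphs : GraphClass := fun V _ => Finite V

/-- The class of graphs containing an induced copy of `F`. -/
def inducedClass {U : Type u} (F : SimpleGraph U) : GraphClass :=
  fun _ G => SimpleGraph.IsIndContained F G

/-- The sentence `φ` defines the class `C` within the class `K`. As usual in first-order logic,
graphs have at least one vertex. -/
def DefinesWithin (K C : GraphClass) (φ : GraphFormula) : Prop :=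
  φ.IsSentence ∧
    ∀ (V : Type) [Nonempty V] (G : SimpleGraph V), K V G → (C V G ↔ φ.Models G)

/-- The logical width of `C` within `K`: the minimum variable width of a sentence that defines `C`
within `K`, and `⊤` if there is no such sentence. -/
noncomputable def logicalWidth (K C : GraphClass) : ℕ∞ :=
  ⨅ φ : {φ : GraphFormula // DefinesWithin K C φ}, (φ.1.width : ℕ∞)

/-! ### Graph constructions -/

/-- The `k`-extension property: for all disjoint sets `X`, `Y` of vertices with fewer than `k`
elements in total there is a vertex outside `X ∪ Y` adjacent to everything in `X` and to nothing
in `Y`. -/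
def ExtensionProperty {V : Type u} (k : ℕ) (G : SimpleGraph V) : Prop :=
  ∀ X Y : Finset V, Disjoint X Y → X.card + Y.card < k →
    ∃ z, z ∉ X ∧ z ∉ Y ∧ (∀ x ∈ X, G.Adj z x) ∧ ∀ y ∈ Y, ¬ G.Adj z y

/-- The lexicographic product `A · B`. -/
def lexProduct {V : Type u} {W : Type v} (A : SimpleGraph V) (B : SimpleGraph W) :
    SimpleGraph (V × W) where
  Adj p q := A.Adj p.1 q.1 ∨ (p.1 = q.1 ∧ B.Adj p.2 q.2)
  symm := ⟨by
    rintro p q (h | ⟨h, h'⟩)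
    · exact Or.inl h.symm
    · exact Or.inr ⟨h.symm, h'.symm⟩⟩
  loopless := ⟨by
    rintro p (h | ⟨_, h⟩)
    · exact A.loopless.irrefl _ h
    · exact B.loopless.irrefl _ h⟩

/-- The vertex set of the power `X^i` of a graph `X` with vertex set `V`. -/
def PowVert (V : Type u) : ℕ → Type u
  | 0 => V
  | 1 => V
  | n + 2 => PowVert V (n + 1) ⊕ PowVert V (n + 1)

/-- The power `X^i`, where `X^1 = X` and `X^(i+1)` is the complement of the disjoint union
`X^i + X^i`. Only exponents `i ≥ 1` are meaningful. -/
def graphPow {V : Type u} (X : SimpleGraph V) : (i : ℕ) → SimpleGraph (PowVert V i)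
  | 0 => X
  | 1 => X
  | n + 2 => (SimpleGraph.sum (graphPow X (n + 1)) (graphPow X (n + 1)))ᶜ

/-- `H_i = (K₁)^i`. -/
def graphH (i : ℕ) : SimpleGraph (PowVert Unit i) := graphPow (⊤ : SimpleGraph Unit) i

/-- `G_i = H_i · (A · H_i)`. -/
def graphG {V : Type u} (A : SimpleGraph V) (i : ℕ) :
    SimpleGraph (PowVert Unit i × (V × PowVert Unit i)) :=
  lexProduct (graphH i) (lexProduct A (graphH i))

/-- Cographs: graphs built from copies of `K₁` by disjoint unions and complementations
(up to isomorphism). -/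
inductive IsCograph : {V : Type u} → SimpleGraph V → Prop
  | single : IsCograph (⊤ : SimpleGraph PUnit.{u + 1})
  | sum {V W : Type u} {G : SimpleGraph V} {H : SimpleGraph W} :
      IsCograph G → IsCograph H → IsCograph (SimpleGraph.sum G H)
  | compl {V : Type u} {G : SimpleGraph V} : IsCograph G → IsCograph Gᶜ
  | iso {V W : Type u} {G : SimpleGraph V} {H : SimpleGraph W} :
      Nonempty (G ≃g H) → IsCograph G → IsCograph H

/-- `P₄`, the path on 4 vertices. -/
def pathFour : SimpleGraph (Fin 4) := SimpleGraph.pathGraph 4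

/-! ### Satisfaction of formulas -/

namespace GraphFormula

/-! Vertices of `graphH (n + 1)` are the leaves of a complete binary tree of depth `n`, two of them
being adjacent iff their lowest common ancestor has even depth. For `n` even, `graphG A (n + 1)`
obeys the same parity rule on the levels `0, …, 2n + 1`, except at level `n`, where adjacency is
that of `A`. The two graphs are compared by the three-pebble Ehrenfeucht–Fraïssé game. Two pebbles
are described by their adjacency and their level; with `r` rounds left, levels are compared exactly
near the root and near the leaves, and are interchangeable in between. Three distinct leaves of a
binary tree form an isosceles triangle: two of the pairs have equal level, hence equal adjacency,
and the third pair meets strictly lower. Three vertices of one copy of `A` break this, all their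
levels being `n`. But among three adjacency bits two agree, so such a triangle passes for an
isosceles one whose levels are too far from both ends to be counted exactly. Hence every third
pebble can be answered (`exists_extension`), and formulas with three variables and depth about `n /
4` do not separate the graphs (`sat_iff`). Since `graphG A (n + 1)` inherits an induced path from
`A` and cographs have none, three variables do not suffice; four clearly do. -/

theorem sat_congr {V : Type u} (G : SimpleGraph V) (φ : GraphFormula) :
    ∀ s t : ℕ → V, (∀ x ∈ φ.freeVars, s x = t x) → (Sat G s φ ↔ Sat G t φ) := by
  have upd : ∀ (F : Finset ℕ) (x : ℕ) (s t : ℕ → V) (a : V), (∀ y ∈ F.erase x, s y = t y) →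
      ∀ y ∈ F, Function.update s x a y = Function.update t x a y := by
    intro F x s t a h y hy
    by_cases hyx : y = x
    · subst hyx; simp
    · simpa [hyx] using h y (Finset.mem_erase.2 ⟨hyx, hy⟩)
  induction φ with
  | equal x y => intro s t h; simp [freeVars] at h; simp [Sat, h]
  | adj x y => intro s t h; simp [freeVars] at h; simp [Sat, h]
  | neg φ ih => intro s t h; exact not_congr (ih s t h)
  | conj φ ψ ihφ ihψ =>
    intro s t h
    exact and_congr (ihφ s t fun x hx => h x (Finset.mem_union_left _ hx))
      (ihψ s t fun x hx => h x (Finset.mem_union_right _ hx))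
  | disj φ ψ ihφ ihψ =>
    intro s t h
    exact or_congr (ihφ s t fun x hx => h x (Finset.mem_union_left _ hx))
      (ihψ s t fun x hx => h x (Finset.mem_union_right _ hx))
  | ex x φ ih => intro s t h; exact exists_congr fun a => ih _ _ (upd _ x s t a h)
  | all x φ ih => intro s t h; exact forall_congr' fun a => ih _ _ (upd _ x s t a h)

theorem IsSentence.models_iff {V : Type u} {G : SimpleGraph V} {φ : GraphFormula}
    (hφ : φ.IsSentence) (s : ℕ → V) : Models G φ ↔ Sat G s φ := by
  refine ⟨fun h => h s, fun h t => (sat_congr G φ s t ?_).1 h⟩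
  rw [show φ.freeVars = ∅ from hφ]
  simp

end GraphFormula

theorem Finset.exists_subset_pair {α : Type*} [DecidableEq α] (S : Finset α) (a : α)
    (h : S.card ≤ 2) : ∃ x y, S ⊆ {x, y} ∧ (x = a ∨ x ∈ S) ∧ (y = a ∨ y ∈ S) := by
  obtain h0 | h1 | h2 : S.card = 0 ∨ S.card = 1 ∨ S.card = 2 := by omega
  · exact ⟨a, a, by simp [Finset.card_eq_zero.1 h0]⟩
  · obtain ⟨x, rfl⟩ := Finset.card_eq_one.1 h1
    exact ⟨x, x, by simp⟩
  · obtain ⟨x, y, -, rfl⟩ := Finset.card_eq_two.1 h2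
    exact ⟨x, y, by simp⟩

/-! ### Graphs with a level function -/

/-- `ℓ` assigns levels `0, …, N` to pairs of vertices, level `N` being equality. The levels of a
triangle are as for the lowest common ancestor in a binary tree, and adjacency is given by the
parity of the level, except possibly for levels at distance at least `K` from the top and more than
`K` from the bottom. -/
structure IsLevelFunction {V : Type*} (G : SimpleGraph V) (ℓ : V → V → ℕ) (N K : ℕ) : Prop where
  le : ∀ x y, ℓ x y ≤ N
  eq_iff : ∀ x y, ℓ x y = N ↔ x = y
  comm : ∀ x y, ℓ x y = ℓ y x
  triangle : ∀ x y z, (ℓ x z = ℓ y z ∧ ℓ x z < ℓ x y) ∨ (ℓ y z = ℓ x y ∧ ℓ x y < ℓ x z) ∨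
    (ℓ x z = ℓ x y ∧ ℓ x y < ℓ y z) ∨ (x = y ∧ y = z) ∨
    (ℓ x z = ℓ x y ∧ ℓ y z = ℓ x y ∧ K ≤ ℓ x y ∧ K < N - ℓ x y)
  adj_top : ∀ x y, ℓ x y < K → x ≠ y → (G.Adj x y ↔ Even (ℓ x y))
  adj_bot : ∀ x y, N - ℓ x y ≤ K → x ≠ y → (G.Adj x y ↔ Even (N - ℓ x y))
  adj_congr : ∀ x y z, ℓ x y < ℓ x z → (G.Adj y x ↔ G.Adj y z)
  exists_level : ∀ x e, e ≤ N → e < K ∨ N - e ≤ K → ∃ z, ℓ x z = e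
  le_size : K ≤ N

/-- A pair of level `e` in a graph with lowest level `N` cannot be told in `r` rounds from a pair of
level `e'` in a graph with lowest level `N'`. -/
def LevelEquiv (r N N' e e' : ℕ) : Prop :=
  (e = e' ∨ (2 * r ≤ e ∧ 2 * r ≤ e')) ∧
    (N - e = N' - e' ∨ (2 * r + 1 ≤ N - e ∧ 2 * r + 1 ≤ N' - e'))

namespace IsLevelFunction

variable {V W : Type*} {G : SimpleGraph V} {H : SimpleGraph W} {ℓ : V → V → ℕ} {ℓ' : W → W → ℕ}
  {N N' K : ℕ}

/-- The reply when the new vertex leaves the tree above the common ancestor of the old pair, so that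
both old vertices see it at one level and with one adjacency `P`. The second alternative in `hed`
serves a triangle inside a copy of `A`: there `e = d`, but being in the middle it may be treated as
lying strictly above. -/
theorem exists_above (h' : IsLevelFunction H ℓ' N' K) {r : ℕ} (hK : 4 * r + 2 ≤ K)
    {x y : W} {d e : ℕ} {P : Prop} (hN : K ≤ N) (hd : d ≤ N)
    (hdd : LevelEquiv (r + 1) N N' d (ℓ' x y))
    (hed : e < d ∨ (2 * r + 2 ≤ e ∧ 2 * r + 3 ≤ N - e ∧ e = d))
    (htop : e < K → (P ↔ Even e)) (hbot : N - e ≤ K → (P ↔ Even (N - e))) :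
    ∃ z, ℓ' x z < ℓ' x y ∧ ℓ' y z = ℓ' x z ∧ LevelEquiv r N N' e (ℓ' x z) ∧
      (H.Adj x z ↔ P) ∧ (H.Adj y z ↔ P) := by
  have hN' := h'.le_size
  have hd' := h'.le x y
  suffices ∃ f, f < ℓ' x y ∧ LevelEquiv r N N' e f ∧
      ((f < K ∧ (Even f ↔ P)) ∨ (N' - f ≤ K ∧ (Even (N' - f) ↔ P))) by
    obtain ⟨f, hf, hef, hP⟩ := this
    obtain ⟨z, hz⟩ := h'.exists_level x f (by omega) (by omega)
    have hyz : ℓ' y z = ℓ' x z := by have := h'.triangle x y z; grind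
    have hxz : x ≠ z := by
      intro hc; have := (h'.eq_iff x z).2 hc; omega
    have hadj : H.Adj x z ↔ P := by
      rcases hP with ⟨h1, h2⟩ | ⟨h1, h2⟩
      · rw [h'.adj_top x z (by omega) hxz, hz, h2]
      · rw [h'.adj_bot x z (by omega) hxz, hz, h2]
    refine ⟨z, by omega, hyz, by rwa [hz], hadj, ?_⟩
    rw [← hadj, H.adj_comm y z, H.adj_comm x z]
    exact (h'.adj_congr x z y (by omega)).symm
  unfold LevelEquiv at *
  by_cases h1 : e < 2 * r
  · exact ⟨e, by omega, by omega, Or.inl ⟨by omega, (htop (by omega)).symm⟩⟩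
  by_cases h2 : N - e < 2 * r + 1
  · refine ⟨N' - (N - e), by omega, by omega, Or.inr ⟨by omega, ?_⟩⟩
    rw [hbot (by omega), show N' - (N' - (N - e)) = N - e by omega]
  -- Level `e` is now far from both ends, so the highest uncounted level whose parity realises `P`
  -- will do. The bound `4 * r + 2 ≤ K` leaves at least `2 * r + 1` levels below it.
  by_cases hP : P
  · refine ⟨2 * r, by omega, by omega, Or.inl ⟨by omega, by simp [hP]⟩⟩
  · refine ⟨2 * r + 1, ?_, by omega, Or.inl ⟨by omega, by simp [hP]⟩⟩
    -- Without room for `2 * r + 1` above the pair, its level is small enough to be copied exactly,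
    -- which forces `e = 2 * r`, of the wrong parity.
    by_contra hc
    have he : e = 2 * r := by omega
    exact hP ((htop (by omega)).2 (by simp [he]))

/-- Mirror image of `exists_above`: the new vertex branches off from `x` below its common ancestor
with `y`, so `y` sees it as it sees `x`. Middle levels are now replaced by levels close to the
leaves, and `e = N` is the case of the new vertex being `x` itself. -/
theorem exists_below (h' : IsLevelFunction H ℓ' N' K) {r : ℕ} (hK : 4 * r + 2 ≤ K)
    {x y : W} {d e : ℕ} {P : Prop} (hN : K ≤ N) (he : e ≤ N)
    (hdd : LevelEquiv (r + 1) N N' d (ℓ' x y))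
    (hed : d < e ∨ (2 * r + 2 ≤ e ∧ 2 * r + 3 ≤ N - e ∧ e = d))
    (htop : e < K → (P ↔ Even e)) (hbot : N - e ≤ K → e < N → (P ↔ Even (N - e)))
    (heq : e = N → ¬ P) :
    ∃ z, ℓ' x y < ℓ' x z ∧ ℓ' y z = ℓ' x y ∧ LevelEquiv r N N' e (ℓ' x z) ∧
      (H.Adj x z ↔ P) ∧ (H.Adj y z ↔ H.Adj x y) := by
  have hN' := h'.le_size
  have hd' := h'.le x y
  suffices ∃ f, f ≤ N' ∧ ℓ' x y < f ∧ LevelEquiv r N N' e f ∧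
      ((f < K ∧ f < N' ∧ (Even f ↔ P)) ∨ (N' - f ≤ K ∧ f < N' ∧ (Even (N' - f) ↔ P)) ∨
        (f = N' ∧ ¬ P)) by
    obtain ⟨f, hf, hxf, hef, hP⟩ := this
    obtain ⟨z, hz⟩ := h'.exists_level x f (by omega) (by omega)
    have hyz : ℓ' y z = ℓ' x y := by have := h'.triangle x y z; have := h'.eq_iff x y; grind
    have hxz : f < N' → x ≠ z := by
      intro hf hc; have := (h'.eq_iff x z).2 hc; omega
    have hadj : H.Adj x z ↔ P := by
      rcases hP with ⟨h1, h0, h2⟩ | ⟨h1, h0, h2⟩ | ⟨h1, h2⟩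
      · rw [h'.adj_top x z (by omega) (hxz h0), hz, h2]
      · rw [h'.adj_bot x z (by omega) (hxz h0), hz, h2]
      · obtain rfl := (h'.eq_iff x z).1 (by omega)
        simpa using h2
    refine ⟨z, by omega, hyz, by rwa [hz], hadj, ?_⟩
    rw [H.adj_comm x y]
    exact (h'.adj_congr x y z (by omega)).symm
  unfold LevelEquiv at *
  by_cases h0 : e = N
  · exact ⟨N', by omega, by omega, by omega, Or.inr (Or.inr ⟨rfl, heq h0⟩)⟩
  by_cases h1 : N - e < 2 * r + 1
  · refine ⟨N' - (N - e), by omega, by omega, by omega, Or.inr (Or.inl ⟨by omega, by omega, ?_⟩)⟩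
    rw [hbot (by omega) (by omega), show N' - (N' - (N - e)) = N - e by omega]
  by_cases h2 : e < 2 * r
  · exact ⟨e, by omega, by omega, by omega, Or.inl ⟨by omega, by omega, (htop (by omega)).symm⟩⟩
  by_cases hP : P
  · refine ⟨N' - (2 * r + 2), by omega, ?_, by omega, Or.inr (Or.inl ⟨by omega, by omega, ?_⟩)⟩
    · by_contra hc
      have he : N - e = 2 * r + 1 := by omega
      have := (hbot (by omega) (by omega)).1 hP
      rw [he] at this
      exact absurd this (by simp)
    · rw [show N' - (N' - (2 * r + 2)) = 2 * (r + 1) by omega]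
      simp [hP]
  · refine ⟨N' - (2 * r + 1), by omega, by omega, by omega,
      Or.inr (Or.inl ⟨by omega, by omega, ?_⟩)⟩
    rw [show N' - (N' - (2 * r + 1)) = 2 * r + 1 by omega]
    simp [hP]

end IsLevelFunction

/-- The pairs `(x, y)` and `(x', y')` cannot be told apart in `r` rounds. -/
def PairEquiv {V W : Type*} (G : SimpleGraph V) (H : SimpleGraph W) (ℓ : V → V → ℕ)
    (ℓ' : W → W → ℕ) (N N' r : ℕ) (x y : V) (x' y' : W) : Prop :=
  (G.Adj x y ↔ H.Adj x' y') ∧ LevelEquiv r N N' (ℓ x y) (ℓ' x' y')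

/-! ### The three-pebble game -/

namespace IsLevelFunction

variable {V W : Type*} {G : SimpleGraph V} {H : SimpleGraph W} {ℓ : V → V → ℕ} {ℓ' : W → W → ℕ}
  {N N' K : ℕ}

theorem pairEquiv_comm (h : IsLevelFunction G ℓ N K) (h' : IsLevelFunction H ℓ' N' K) {r : ℕ}
    {x y : V} {x' y' : W} (hp : PairEquiv G H ℓ ℓ' N N' r x y x' y') :
    PairEquiv G H ℓ ℓ' N N' r y x y' x' := by
  unfold PairEquiv at *
  rwa [G.adj_comm, H.adj_comm, h.comm, h'.comm]

theorem pairEquiv_refl (h : IsLevelFunction G ℓ N K) (h' : IsLevelFunction H ℓ' N' K) {r : ℕ}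
    (hr : 2 * r ≤ K) (x : V) (x' : W) : PairEquiv G H ℓ ℓ' N N' r x x x' x' := by
  have := h.le_size
  have := h'.le_size
  have := (h.eq_iff x x).2 rfl
  have := (h'.eq_iff x' x').2 rfl
  refine ⟨by simp, ?_⟩
  unfold LevelEquiv
  omega

theorem pairEquiv_eq_iff (h : IsLevelFunction G ℓ N K) (h' : IsLevelFunction H ℓ' N' K) {r : ℕ}
    {x y : V} {x' y' : W} (hp : PairEquiv G H ℓ ℓ' N N' r x y x' y') : x = y ↔ x' = y' := by
  rw [← h.eq_iff, ← h'.eq_iff]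
  have := hp.2
  have := h.le x y
  have := h'.le x' y'
  unfold LevelEquiv at *
  omega

theorem _root_.PairEquiv.symm {r : ℕ} {x y : V} {x' y' : W}
    (hp : PairEquiv G H ℓ ℓ' N N' r x y x' y') : PairEquiv H G ℓ' ℓ N' N r x' y' x y := by
  obtain ⟨h1, h2⟩ := hp
  refine ⟨h1.symm, ?_⟩
  unfold LevelEquiv at *
  omega

theorem _root_.PairEquiv.of_succ {r : ℕ} {x y : V} {x' y' : W}
    (hp : PairEquiv G H ℓ ℓ' N N' (r + 1) x y x' y') : PairEquiv G H ℓ ℓ' N N' r x y x' y' := by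
  obtain ⟨h1, h2⟩ := hp
  refine ⟨h1, ?_⟩
  unfold LevelEquiv at *
  omega

/-- One move of the game. Each shape of the triangle on `x`, `y`, `z` says which pair is closest,
hence whether `z` branches off above the pair `x`, `y`, or below it next to `x` or to `y`. -/
theorem exists_extension (h : IsLevelFunction G ℓ N K) (h' : IsLevelFunction H ℓ' N' K)
    {r : ℕ} (hK : 4 * r + 2 ≤ K) {x y : V} {x' y' : W}
    (hp : PairEquiv G H ℓ ℓ' N N' (r + 1) x y x' y') (z : V) :
    ∃ z', PairEquiv G H ℓ ℓ' N N' r x z x' z' ∧ PairEquiv G H ℓ ℓ' N N' r y z y' z' := by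
  have hN := h.le_size
  have top : ∀ u v, ℓ u v < K → (G.Adj u v ↔ Even (ℓ u v)) := fun u v huv => by
    by_cases hc : u = v
    · subst hc
      have := (h.eq_iff u u).2 rfl
      omega
    · exact h.adj_top u v huv hc
  have bot : ∀ u v, N - ℓ u v ≤ K → ℓ u v < N → (G.Adj u v ↔ Even (N - ℓ u v)) :=
    fun u v huv hlt => h.adj_bot u v huv fun hc => by
      have := (h.eq_iff u v).2 hc
      omega
  have below : ∀ (u v : V) (u' v' : W), PairEquiv G H ℓ ℓ' N N' (r + 1) u v u' v' →
      (ℓ v z = ℓ u v ∧ (G.Adj v z ↔ G.Adj u v)) →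
      (ℓ u v < ℓ u z ∨ (2 * r + 2 ≤ ℓ u z ∧ 2 * r + 3 ≤ N - ℓ u z ∧ ℓ u z = ℓ u v)) →
      ∃ z', PairEquiv G H ℓ ℓ' N N' r u z u' z' ∧ PairEquiv G H ℓ ℓ' N N' r v z v' z' := by
    intro u v u' v' hp huv hlt
    obtain ⟨z', -, h2, h3, h4, h5⟩ := h'.exists_below hK (P := G.Adj u z) hN (h.le u z) hp.2 hlt
      (top u z) (bot u z) (fun he => by obtain rfl := (h.eq_iff u z).1 he; simp)
    refine ⟨z', ⟨h4.symm, h3⟩, ?_, ?_⟩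
    · rw [huv.2, h5, hp.1]
    · rw [huv.1, h2]
      exact hp.of_succ.2
  have above : ((G.Adj y z ↔ G.Adj x z) ∧ ℓ y z = ℓ x z) →
      (ℓ x z < ℓ x y ∨ (2 * r + 2 ≤ ℓ x z ∧ 2 * r + 3 ≤ N - ℓ x z ∧ ℓ x z = ℓ x y)) →
      ∃ z', PairEquiv G H ℓ ℓ' N N' r x z x' z' ∧ PairEquiv G H ℓ ℓ' N N' r y z y' z' := by
    intro hxy hlt
    have hd := h.le x y
    obtain ⟨z', -, h2, h3, h4, h5⟩ := h'.exists_above hK (P := G.Adj x z) hN hd hp.2 hlt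
      (top x z) (fun hb => bot x z hb (by omega))
    refine ⟨z', ⟨h4.symm, h3⟩, ?_, ?_⟩
    · rw [hxy.1, h5]
    · rwa [hxy.2, h2]
  have hcomm := h.comm x y
  rcases h.triangle x y z with ⟨h1, h2⟩ | ⟨h1, h2⟩ | ⟨h1, h2⟩ | ⟨rfl, rfl⟩ | ⟨h1, h2, h3, h4⟩
  · refine above ⟨?_, h1.symm⟩ (Or.inl h2)
    rw [G.adj_comm y z, G.adj_comm x z]
    exact (h.adj_congr x z y h2).symm
  · refine below x y x' y' hp ⟨h1, ?_⟩ (Or.inl h2)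
    rw [G.adj_comm x y]
    exact (h.adj_congr x y z h2).symm
  · obtain ⟨z', ha, hb⟩ := below y x y' x' (h.pairEquiv_comm h' hp)
      ⟨by omega, (h.adj_congr y x z (by omega)).symm.trans (G.adj_comm x y)⟩ (Or.inl (by omega))
    exact ⟨z', hb, ha⟩
  · obtain rfl := (h.pairEquiv_eq_iff h' hp).1 rfl
    exact ⟨x', hp.of_succ, hp.of_succ⟩
  · by_cases hxy : G.Adj y z ↔ G.Adj x z
    · exact above ⟨hxy, by omega⟩ (by omega)
    by_cases hy : G.Adj y z ↔ G.Adj x y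
    · exact below x y x' y' hp ⟨h2, hy⟩ (by omega)
    · have hx : G.Adj x z ↔ G.Adj y x := by rw [G.adj_comm y x]; tauto
      obtain ⟨z', ha, hb⟩ := below y x y' x' (h.pairEquiv_comm h' hp) ⟨by omega, hx⟩ (by omega)
      exact ⟨z', hb, ha⟩

/-- Requantifying one of three variables leaves at most two others, so a reply to a single pair
suffices; if fewer remain, `x` itself fills the gap. -/
theorem exists_update (h : IsLevelFunction G ℓ N K) (h' : IsLevelFunction H ℓ' N' K)
    {S : Finset ℕ} (hS : S.card ≤ 3) {x : ℕ} (hx : x ∈ S) {r : ℕ} (hr : 4 * r + 2 ≤ K)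
    {s : ℕ → V} {t : ℕ → W}
    (hst : ∀ i ∈ S, ∀ j ∈ S, PairEquiv G H ℓ ℓ' N N' (r + 1) (s i) (s j) (t i) (t j)) (a : V) :
    ∃ b, ∀ i ∈ S, ∀ j ∈ S, PairEquiv G H ℓ ℓ' N N' r (Function.update s x a i)
      (Function.update s x a j) (Function.update t x b i) (Function.update t x b j) := by
  obtain ⟨y, z, hyz, hy, hz⟩ := (S.erase x).exists_subset_pair x
    (by rw [Finset.card_erase_of_mem hx]; omega)
  have hyS : y ∈ S := hy.elim (fun h => h ▸ hx) Finset.mem_of_mem_erase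
  have hzS : z ∈ S := hz.elim (fun h => h ▸ hx) Finset.mem_of_mem_erase
  obtain ⟨b, hyb, hzb⟩ := h.exists_extension h' hr (hst y hyS z hzS) a
  have key : ∀ i ∈ S, i ≠ x → PairEquiv G H ℓ ℓ' N N' r (s i) a (t i) b := by
    intro i hi hix
    have := hyz (Finset.mem_erase.2 ⟨hix, hi⟩)
    simp only [Finset.mem_insert, Finset.mem_singleton] at this
    rcases this with rfl | rfl
    · exact hyb
    · exact hzb
  refine ⟨b, fun i hi j hj => ?_⟩
  by_cases hix : i = x <;> by_cases hjx : j = x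
  · simpa [hix, hjx] using h.pairEquiv_refl h' (by omega) a b
  · simpa [hix, hjx] using h.pairEquiv_comm h' (key j hj hjx)
  · simpa [hix, hjx] using key i hi hix
  · simpa [hix, hjx] using (hst i hi j hj).of_succ

open GraphFormula in
theorem sat_iff (h : IsLevelFunction G ℓ N K) (h' : IsLevelFunction H ℓ' N' K) {S : Finset ℕ}
    (hS : S.card ≤ 3) (φ : GraphFormula) (hφ : φ.vars ⊆ S) :
    ∀ (r : ℕ) (s : ℕ → V) (t : ℕ → W), φ.depth ≤ r → 4 * r ≤ K + 2 →
      (∀ i ∈ S, ∀ j ∈ S, PairEquiv G H ℓ ℓ' N N' r (s i) (s j) (t i) (t j)) →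
      (Sat G s φ ↔ Sat H t φ) := by
  induction φ with
  | equal x y =>
    intro r s t _ _ hst
    exact h.pairEquiv_eq_iff h' (hst x (hφ (by simp [vars])) y (hφ (by simp [vars])))
  | adj x y =>
    intro r s t _ _ hst
    exact (hst x (hφ (by simp [vars])) y (hφ (by simp [vars]))).1
  | neg φ ih => intro r s t hd hr hst; exact not_congr (ih hφ r s t hd hr hst)
  | conj φ ψ ihφ ihψ =>
    intro r s t hd hr hst
    exact and_congr
      (ihφ (Finset.union_subset_left hφ) r s t ((le_max_left _ _).trans hd) hr hst)
      (ihψ (Finset.union_subset_right hφ) r s t ((le_max_right _ _).trans hd) hr hst)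
  | disj φ ψ ihφ ihψ =>
    intro r s t hd hr hst
    exact or_congr
      (ihφ (Finset.union_subset_left hφ) r s t ((le_max_left _ _).trans hd) hr hst)
      (ihψ (Finset.union_subset_right hφ) r s t ((le_max_right _ _).trans hd) hr hst)
  | ex x φ ih =>
    intro r s t hd hr hst
    obtain ⟨hx, hφ⟩ := Finset.insert_subset_iff.1 hφ
    obtain _ | r := r
    · simp [depth] at hd
    have hd' : φ.depth ≤ r := by simpa [depth] using hd
    constructor
    · rintro ⟨a, ha⟩
      obtain ⟨b, hb⟩ := h.exists_update h' hS hx (by omega) hst a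
      exact ⟨b, (ih hφ r _ _ hd' (by omega) hb).1 ha⟩
    · rintro ⟨b, hb⟩
      obtain ⟨a, ha⟩ := h'.exists_update h hS hx (by omega)
        (fun i hi j hj => (hst i hi j hj).symm) b
      exact ⟨a, (ih hφ r _ _ hd' (by omega) fun i hi j hj => (ha i hi j hj).symm).2 hb⟩
  | all x φ ih =>
    intro r s t hd hr hst
    obtain ⟨hx, hφ⟩ := Finset.insert_subset_iff.1 hφ
    obtain _ | r := r
    · simp [depth] at hd
    have hd' : φ.depth ≤ r := by simpa [depth] using hd
    constructor
    · intro hs b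
      obtain ⟨a, ha⟩ := h'.exists_update h hS hx (by omega)
        (fun i hi j hj => (hst i hi j hj).symm) b
      exact (ih hφ r _ _ hd' (by omega) fun i hi j hj => (ha i hi j hj).symm).1 (hs a)
    · intro ht a
      obtain ⟨b, hb⟩ := h.exists_update h' hS hx (by omega) hst a
      exact (ih hφ r _ _ hd' (by omega) hb).2 (ht b)

theorem le_logicalDepthWith (h : IsLevelFunction G ℓ N K) (h' : IsLevelFunction H ℓ' N' K)
    [Nonempty V] [Nonempty W] {m : ℕ} (hm : 4 * m + 2 ≤ K) :
    (m : ℕ∞) + 2 ≤ logicalDepthWith 3 G H := by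
  refine le_iInf ?_
  rintro ⟨φ, hφ, hw, hdist⟩
  by_contra hlt
  have hd : φ.depth < m + 2 := by
    have := not_le.1 hlt
    exact_mod_cast this
  obtain ⟨a⟩ := ‹Nonempty V›
  obtain ⟨b⟩ := ‹Nonempty W›
  -- All variables start on one vertex, so every initial pair is diagonal. With `m + 1` rounds the
  -- requirement `4 * r ≤ K + 2` is exactly `hm`.
  have := h.sat_iff h' (S := φ.vars) hw φ subset_rfl (m + 1) (fun _ => a) (fun _ => b)
    (by omega) (by omega) (fun i _ j _ => h.pairEquiv_refl h' (by omega) a b)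
  rw [← hφ.models_iff, ← hφ.models_iff] at this
  rcases hdist with h1 | h1 <;> tauto

end IsLevelFunction

/-! ### The level functions of `H_i` and `G_i` -/

/-- Vertices of `H_i` are leaves of a binary tree; this is the depth of the lowest common ancestor
of two of them. -/
def powLevel : (i : ℕ) → PowVert Unit i → PowVert Unit i → ℕ
  | 0, _, _ => 0
  | 1, _, _ => 0
  | n + 2, Sum.inl a, Sum.inl b => powLevel (n + 1) a b + 1
  | n + 2, Sum.inr a, Sum.inr b => powLevel (n + 1) a b + 1
  | _ + 2, Sum.inl _, Sum.inr _ => 0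
  | _ + 2, Sum.inr _, Sum.inl _ => 0

theorem powLevel_le : ∀ (n : ℕ) (x y : PowVert Unit (n + 1)), powLevel (n + 1) x y ≤ n
  | 0, _, _ => le_rfl
  | n + 1, Sum.inl a, Sum.inl b => Nat.succ_le_succ (powLevel_le n a b)
  | n + 1, Sum.inr a, Sum.inr b => Nat.succ_le_succ (powLevel_le n a b)
  | _ + 1, Sum.inl _, Sum.inr _ => Nat.zero_le _
  | _ + 1, Sum.inr _, Sum.inl _ => Nat.zero_le _

theorem powLevel_eq_iff : ∀ (n : ℕ) (x y : PowVert Unit (n + 1)),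
    powLevel (n + 1) x y = n ↔ x = y
  | 0, _, _ => ⟨fun _ => rfl, fun _ => rfl⟩
  | n + 1, Sum.inl a, Sum.inl b =>
    Nat.succ_inj.trans ((powLevel_eq_iff n a b).trans Sum.inl_injective.eq_iff.symm)
  | n + 1, Sum.inr a, Sum.inr b =>
    Nat.succ_inj.trans ((powLevel_eq_iff n a b).trans Sum.inr_injective.eq_iff.symm)
  | _ + 1, Sum.inl _, Sum.inr _ => ⟨fun h => by simp [powLevel] at h, fun h => by cases h⟩
  | _ + 1, Sum.inr _, Sum.inl _ => ⟨fun h => by simp [powLevel] at h, fun h => by cases h⟩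

theorem powLevel_comm : ∀ (n : ℕ) (x y : PowVert Unit (n + 1)),
    powLevel (n + 1) x y = powLevel (n + 1) y x
  | 0, _, _ => rfl
  | n + 1, Sum.inl a, Sum.inl b => congrArg (· + 1) (powLevel_comm n a b)
  | n + 1, Sum.inr a, Sum.inr b => congrArg (· + 1) (powLevel_comm n a b)
  | _ + 1, Sum.inl _, Sum.inr _ => rfl
  | _ + 1, Sum.inr _, Sum.inl _ => rfl

/-- The tree is binary, so three distinct leaves cannot all part at one node; this is where the
inequalities become strict. -/
theorem powLevel_triangle : ∀ (n : ℕ) (x y z : PowVert Unit (n + 1)),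
    (powLevel (n + 1) x z = powLevel (n + 1) y z ∧ powLevel (n + 1) x z < powLevel (n + 1) x y) ∨
    (powLevel (n + 1) y z = powLevel (n + 1) x y ∧ powLevel (n + 1) x y < powLevel (n + 1) x z) ∨
    (powLevel (n + 1) x z = powLevel (n + 1) x y ∧ powLevel (n + 1) x y < powLevel (n + 1) y z) ∨
    (x = y ∧ y = z)
  | 0, _, _, _ => Or.inr (Or.inr (Or.inr ⟨rfl, rfl⟩))
  | n + 1, Sum.inl a, Sum.inl b, Sum.inl c => by
    simp only [powLevel]
    rcases powLevel_triangle n a b c with h | h | h | ⟨rfl, rfl⟩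
    · omega
    · omega
    · omega
    · exact Or.inr (Or.inr (Or.inr ⟨rfl, rfl⟩))
  | n + 1, Sum.inr a, Sum.inr b, Sum.inr c => by
    simp only [powLevel]
    rcases powLevel_triangle n a b c with h | h | h | ⟨rfl, rfl⟩
    · omega
    · omega
    · omega
    · exact Or.inr (Or.inr (Or.inr ⟨rfl, rfl⟩))
  | _ + 1, Sum.inl _, Sum.inl _, Sum.inr _ => by simp [powLevel]
  | _ + 1, Sum.inl _, Sum.inr _, Sum.inl _ => by simp [powLevel]
  | _ + 1, Sum.inr _, Sum.inl _, Sum.inl _ => by simp [powLevel]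
  | _ + 1, Sum.inr _, Sum.inr _, Sum.inl _ => by simp [powLevel]
  | _ + 1, Sum.inr _, Sum.inl _, Sum.inr _ => by simp [powLevel]
  | _ + 1, Sum.inl _, Sum.inr _, Sum.inr _ => by simp [powLevel]

theorem graphH_adj_iff : ∀ (n : ℕ) (x y : PowVert Unit (n + 1)),
    (graphH (n + 1)).Adj x y ↔ x ≠ y ∧ Even (powLevel (n + 1) x y)
  | 0, _, _ => (and_iff_left Even.zero).symm
  | n + 1, Sum.inl a, Sum.inl b => by
    have hab : (a ≠ b ∧ ¬ (graphH (n + 1)).Adj a b) ↔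
        (a ≠ b ∧ Even (powLevel (n + 1) a b + 1)) := by
      rw [graphH_adj_iff n a b, Nat.even_add_one]
      tauto
    have hne := Sum.inl_injective (α := PowVert Unit (n + 1)) (β := PowVert Unit (n + 1))
      |>.ne_iff (x := a) (y := b)
    exact (and_congr_left' hne).trans (hab.trans (and_congr_left' hne).symm)
  | n + 1, Sum.inr a, Sum.inr b => by
    have hab : (a ≠ b ∧ ¬ (graphH (n + 1)).Adj a b) ↔
        (a ≠ b ∧ Even (powLevel (n + 1) a b + 1)) := by
      rw [graphH_adj_iff n a b, Nat.even_add_one]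
      tauto
    have hne := Sum.inr_injective (α := PowVert Unit (n + 1)) (β := PowVert Unit (n + 1))
      |>.ne_iff (x := a) (y := b)
    exact (and_congr_left' hne).trans (hab.trans (and_congr_left' hne).symm)
  | _ + 1, Sum.inl _, Sum.inr _ =>
    ⟨fun _ => ⟨Sum.inl_ne_inr, Even.zero⟩, fun _ => ⟨Sum.inl_ne_inr, fun h => nomatch h⟩⟩
  | _ + 1, Sum.inr _, Sum.inl _ =>
    ⟨fun _ => ⟨Sum.inr_ne_inl, Even.zero⟩, fun _ => ⟨Sum.inr_ne_inl, fun h => nomatch h⟩⟩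

theorem exists_powLevel_eq : ∀ (n : ℕ) (x : PowVert Unit (n + 1)) (e : ℕ), e ≤ n →
    ∃ z, powLevel (n + 1) x z = e
  | 0, x, e, he => ⟨x, (Nat.le_zero.1 he).symm⟩
  | _ + 1, Sum.inl a, 0, _ => ⟨Sum.inr a, rfl⟩
  | _ + 1, Sum.inr a, 0, _ => ⟨Sum.inl a, rfl⟩
  | n + 1, Sum.inl a, e + 1, he => by
    obtain ⟨z, hz⟩ := exists_powLevel_eq n a e (by omega)
    exact ⟨Sum.inl z, congrArg (· + 1) hz⟩
  | n + 1, Sum.inr a, e + 1, he => by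
    obtain ⟨z, hz⟩ := exists_powLevel_eq n a e (by omega)
    exact ⟨Sum.inr z, congrArg (· + 1) hz⟩

instance nonempty_powVert : ∀ i : ℕ, Nonempty (PowVert Unit i)
  | 0 => ⟨()⟩
  | 1 => ⟨()⟩
  | n + 2 => (nonempty_powVert (n + 1)).map Sum.inl

instance finite_powVert : ∀ i : ℕ, Finite (PowVert Unit i)
  | 0 => inferInstanceAs (Finite Unit)
  | 1 => inferInstanceAs (Finite Unit)
  | n + 2 =>
    have := finite_powVert (n + 1)
    inferInstanceAs (Finite (PowVert Unit (n + 1) ⊕ PowVert Unit (n + 1)))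

/-- Parities counted from the root and from the leaves agree because `n` is even. With `N = K = n`
no level is exceptional. -/
theorem isLevelFunction_graphH {n : ℕ} (hn : Even n) :
    IsLevelFunction (graphH (n + 1)) (powLevel (n + 1)) n n where
  le := powLevel_le n
  eq_iff := powLevel_eq_iff n
  comm := powLevel_comm n
  triangle x y z := by
    rcases powLevel_triangle n x y z with h | h | h | h
    · exact Or.inl h
    · exact Or.inr (Or.inl h)
    · exact Or.inr (Or.inr (Or.inl h))
    · exact Or.inr (Or.inr (Or.inr (Or.inl h)))
  adj_top x y _ hne := by simp [graphH_adj_iff, hne]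
  adj_bot x y _ hne := by simp [graphH_adj_iff, hne, Nat.even_sub (powLevel_le n x y), hn]
  adj_congr x y z h := by
    have := powLevel_triangle n x y z
    have := powLevel_eq_iff n y x
    have := powLevel_eq_iff n y z
    have := powLevel_le n x z
    have := powLevel_comm n x y
    rw [graphH_adj_iff, graphH_adj_iff]
    grind
  exists_level x e he _ := exists_powLevel_eq n x e he
  le_size := le_rfl

open Classical in
/-- The level function of `G_{n+1}`, in which level `n` belongs to distinct vertices of the same
copy of `A`. -/
noncomputable def lexLevel {V : Type u} (n : ℕ)
    (x y : PowVert Unit (n + 1) × (V × PowVert Unit (n + 1))) : ℕ :=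
  if x.1 = y.1 then if x.2.1 = y.2.1 then n + 1 + powLevel (n + 1) x.2.2 y.2.2 else n
  else powLevel (n + 1) x.1 y.1

/-- The outer factor supplies levels below `n`, the inner one levels above `n`; only level `n`,
governed by `A`, escapes the parity rules. -/
theorem isLevelFunction_graphG {V : Type u} (A : SimpleGraph V) {n : ℕ} (hn : Even n) :
    IsLevelFunction (graphG A (n + 1)) (lexLevel n) (2 * n + 1) n where
  le x y := by
    have := powLevel_le n x.1 y.1
    have := powLevel_le n x.2.2 y.2.2
    unfold lexLevel
    split_ifs <;> omega
  eq_iff x y := by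
    have := powLevel_le n x.1 y.1
    have := powLevel_eq_iff n x.2.2 y.2.2
    rw [Prod.ext_iff, Prod.ext_iff]
    unfold lexLevel
    split_ifs <;> grind
  comm x y := by
    have := powLevel_comm n x.1 y.1
    have := powLevel_comm n x.2.2 y.2.2
    unfold lexLevel
    grind
  triangle x y z := by
    obtain ⟨a, u, b⟩ := x
    obtain ⟨a', u', b'⟩ := y
    obtain ⟨a'', u'', b''⟩ := z
    have h1 := powLevel_triangle n a a' a''
    have h2 := powLevel_triangle n b b' b''
    have := powLevel_eq_iff n a a'
    have := powLevel_eq_iff n a a''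
    have := powLevel_eq_iff n a' a''
    have := powLevel_le n a a'
    have := powLevel_le n a a''
    have := powLevel_le n a' a''
    simp only [lexLevel, Prod.mk.injEq]
    split_ifs <;> grind
  adj_top x y h hne := by
    simp only [graphG, lexProduct, graphH_adj_iff, lexLevel] at *
    split_ifs at * <;> grind
  adj_bot x y h hne := by
    have := powLevel_le n x.1 y.1
    have h2 := powLevel_le n x.2.2 y.2.2
    have := powLevel_eq_iff n x.1 y.1
    have h3 := A.irrefl (v := x.2.1)
    by_cases hx : x.1 = y.1
    · by_cases hu : x.2.1 = y.2.1
      · have hb : x.2.2 ≠ y.2.2 := fun hb => hne (Prod.ext hx (Prod.ext hu hb))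
        have he : 2 * n + 1 - lexLevel n x y = n - powLevel (n + 1) x.2.2 y.2.2 := by
          simp only [lexLevel, hx, hu, if_true]
          omega
        rw [he, Nat.even_sub h2]
        simp [graphG, lexProduct, graphH_adj_iff, hx, hu, hb, hn]
      · simp only [lexLevel, hx, hu, if_true, if_false] at h
        omega
    · simp only [lexLevel, hx, if_false] at h
      omega
  adj_congr x y z h := by
    obtain ⟨a, u, b⟩ := x
    obtain ⟨a', u', b'⟩ := y
    obtain ⟨a'', u'', b''⟩ := z
    have h1 := (isLevelFunction_graphH hn).adj_congr a a' a''
    have h2 := (isLevelFunction_graphH hn).adj_congr b b' b''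
    have := powLevel_eq_iff n a a'
    have := powLevel_eq_iff n a a''
    have := powLevel_le n a a'
    have := powLevel_le n a a''
    simp only [lexLevel] at h
    simp only [graphG, lexProduct]
    split_ifs at h <;> grind
  exists_level x e he hK := by
    obtain ⟨a, u, b⟩ := x
    rcases hK with hK | hK
    · obtain ⟨z, hz⟩ := exists_powLevel_eq n a e hK.le
      have := powLevel_eq_iff n a z
      exact ⟨(z, u, b), by simp only [lexLevel]; grind⟩
    · obtain ⟨z, hz⟩ := exists_powLevel_eq n b (e - (n + 1)) (by omega)
      exact ⟨(a, u, z), by simp only [lexLevel, if_true]; omega⟩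
  le_size := by omega

/-! ### Induced paths on four vertices -/

theorem pathFour_isIndContained_iff {V : Type*} (G : SimpleGraph V) :
    SimpleGraph.IsIndContained pathFour G ↔ ∃ a b c d : V,
      (G.Adj a b ∧ G.Adj b c ∧ G.Adj c d) ∧ ¬ G.Adj a c ∧ ¬ G.Adj b d ∧ ¬ G.Adj a d := by
  constructor
  · rintro ⟨f⟩
    have hf : ∀ i j, G.Adj (f i) (f j) ↔ i.1 + 1 = j.1 ∨ j.1 + 1 = i.1 := fun i j =>
      f.map_adj_iff.trans SimpleGraph.pathGraph_adj
    exact ⟨f 0, f 1, f 2, f 3, by simp [hf]⟩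
  · rintro ⟨a, b, c, d, ⟨hab, hbc, hcd⟩, hac, hbd, had⟩
    have e1 := hab.ne
    have e2 := hbc.ne
    have e3 := hcd.ne
    have e4 : a ≠ c := by rintro rfl; exact had hcd
    have e5 : b ≠ d := by rintro rfl; exact had hab
    have e6 : a ≠ d := by rintro rfl; exact hac hcd.symm
    refine ⟨⟨⟨![a, b, c, d], ?_⟩, ?_⟩⟩
    · intro i j hij
      fin_cases i <;> fin_cases j <;> simp_all
    · intro i j
      change G.Adj (![a, b, c, d] i) (![a, b, c, d] j) ↔ _
      fin_cases i <;> fin_cases j <;>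
        simp_all [pathFour, SimpleGraph.pathGraph_adj, G.adj_comm]

/-- In the triangle `a b c` the odd side is `ac`, so `ab` and `bc` share a level; likewise `bc` and
`cd` share a level, above that of `bd`. In `a b d` the even side `ab` would have to be strictly
deeper than `bd`, a contradiction. -/
theorem not_pathFour_isIndContained_graphH (n : ℕ) :
    ¬ SimpleGraph.IsIndContained pathFour (graphH (n + 1)) := by
  rw [pathFour_isIndContained_iff]
  rintro ⟨a, b, c, d, ⟨hab, hbc, hcd⟩, hac, hbd, had⟩
  have h1 := powLevel_triangle n a b c
  have h2 := powLevel_triangle n b c d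
  have h3 := powLevel_triangle n a b d
  have hne : a ≠ d := by rintro rfl; exact hac hcd.symm
  rw [graphH_adj_iff] at *
  grind

theorem isCograph_graphH : ∀ n : ℕ, IsCograph (graphH (n + 1))
  | 0 => IsCograph.single
  | n + 1 => ((isCograph_graphH n).sum (isCograph_graphH n)).compl

theorem pathFour_isIndContained_graphG {V : Type u} {A : SimpleGraph V}
    (h : SimpleGraph.IsIndContained pathFour A) (i : ℕ) :
    SimpleGraph.IsIndContained pathFour (graphG A i) := by
  obtain ⟨x⟩ := nonempty_powVert i
  refine h.trans ⟨⟨⟨fun v => (x, (v, x)), fun u v huv => ?_⟩, ?_⟩⟩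
  · simpa using huv
  · intro u v
    change ((graphH i).Adj x x ∨ (x = x ∧ (A.Adj u v ∨ (u = v ∧ (graphH i).Adj x x)))) ↔ A.Adj u v
    simp

/-- The rook's graph on a `3 × 3` board. -/
def rookGraph : SimpleGraph (Fin 9) where
  Adj a b := a ≠ b ∧ (a.1 / 3 = b.1 / 3 ∨ a.1 % 3 = b.1 % 3)
  symm := ⟨fun _ _ h => ⟨h.1.symm, h.2.imp Eq.symm Eq.symm⟩⟩
  loopless := ⟨fun _ h => h.1 rfl⟩

instance : DecidableRel rookGraph.Adj := fun a b =>
  inferInstanceAs (Decidable (a ≠ b ∧ (a.1 / 3 = b.1 / 3 ∨ a.1 % 3 = b.1 % 3)))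

/-- A set of at most two vertices is listed as `a`, `b`, possibly equal, with the required
adjacencies as bits; this makes the extension property a finite check. -/
theorem rookGraph_exists_vertex : ∀ (a b : Fin 9) (s t : Bool), (a = b → s = t) →
    ∃ z, z ≠ a ∧ z ≠ b ∧ (rookGraph.Adj z a ↔ s = true) ∧ (rookGraph.Adj z b ↔ t = true) := by
  decide +kernel

theorem extensionProperty_rookGraph : ExtensionProperty 3 rookGraph := by
  intro X Y hXY hcard
  obtain ⟨a, b, hab, -⟩ := (X ∪ Y).exists_subset_pair 0
    ((Finset.card_union_le X Y).trans (by omega))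
  have mem : ∀ w, w ∈ X ∨ w ∈ Y → w = a ∨ w = b := fun w hw => by
    simpa using hab (Finset.mem_union.2 hw)
  obtain ⟨z, hza, hzb, ha, hb⟩ := rookGraph_exists_vertex a b (decide (a ∈ X)) (decide (b ∈ X))
    (fun h => by rw [h])
  rw [decide_eq_true_iff] at ha hb
  refine ⟨z, ?_, ?_, ?_, ?_⟩
  · intro hz; rcases mem z (Or.inl hz) with h | h <;> contradiction
  · intro hz; rcases mem z (Or.inr hz) with h | h <;> contradiction
  · intro x hx
    rcases mem x (Or.inl hx) with rfl | rfl
    · exact ha.2 hx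
    · exact hb.2 hx
  · intro y hy
    have hyX : y ∉ X := fun h => Finset.disjoint_left.1 hXY h hy
    rcases mem y (Or.inr hy) with rfl | rfl
    · exact fun h => hyX (ha.1 h)
    · exact fun h => hyX (hb.1 h)

theorem pathFour_isIndContained_rookGraph :
    SimpleGraph.IsIndContained pathFour rookGraph :=
  (pathFour_isIndContained_iff _).2 ⟨0, 1, 4, 5, by decide⟩

/-! ### The logical width of the class of graphs with an induced `P₄` -/

open GraphFormula in
/-- A sentence with four variables that says that there is an induced `P₄`. -/
def pathFourSentence : GraphFormula :=
  ex 0 (ex 1 (ex 2 (ex 3 (conj (conj (adj 0 1) (conj (adj 1 2) (adj 2 3)))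
    (conj (neg (adj 0 2)) (conj (neg (adj 1 3)) (neg (adj 0 3))))))))

theorem pathFourSentence_definesWithin (K : GraphClass) :
    DefinesWithin K (inducedClass pathFour) pathFourSentence := by
  refine ⟨by unfold GraphFormula.IsSentence; decide, fun V _ G _ => ?_⟩
  simp [inducedClass, pathFour_isIndContained_iff, GraphFormula.Models, pathFourSentence,
    GraphFormula.Sat, Function.update]

theorem four_le_width {φ : GraphFormula}
    (h : DefinesWithin finiteGraphs (inducedClass pathFour) φ) : 4 ≤ φ.width := by
  by_contra hw
  -- The size is chosen so that the depth bound becomes `φ.depth + 2`, beyond the depth of `φ`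
  -- itself.
  have hev : Even (4 * φ.depth + 2) := ⟨2 * φ.depth + 1, by ring⟩
  have hle := (isLevelFunction_graphG rookGraph hev).le_logicalDepthWith
    (isLevelFunction_graphH hev) le_rfl
  have hG := (h.2 _ (graphG rookGraph (4 * φ.depth + 2 + 1))
    (inferInstanceAs (Finite (_ × _)))).1
    (pathFour_isIndContained_graphG pathFour_isIndContained_rookGraph _)
  have hH : ¬ φ.Models (graphH (4 * φ.depth + 2 + 1)) := fun hm =>
    not_pathFour_isIndContained_graphH _ ((h.2 _ _ (finite_powVert _)).2 hm)
  have := hle.trans (iInf_le _ ⟨φ, h.1, by omega, Or.inl ⟨hG, hH⟩⟩)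
  have : φ.depth + 2 ≤ φ.depth := by exact_mod_cast this
  omega

theorem logicalWidth_pathFour {K : GraphClass} (hK : ∀ V G, finiteGraphs V G → K V G) :
    logicalWidth K (inducedClass pathFour) = 4 := by
  refine le_antisymm ?_ (le_iInf ?_)
  · have hw : pathFourSentence.width = 4 := by decide
    refine (iInf_le _ ⟨_, pathFourSentence_definesWithin K⟩).trans ?_
    simp [hw]
  · rintro ⟨φ, hφ⟩
    have := four_le_width ⟨hφ.1, fun V _ G hG => hφ.2 V G (hK V G hG)⟩
    exact_mod_cast this

theorem mainTheorem3 :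
    logicalWidth finiteGraphs (inducedClass pathFour) = 4 ∧
    logicalWidth allGraphs (inducedClass pathFour) = 4 ∧
    (¬ ∃ φ : GraphFormula, φ.width ≤ 3 ∧
      DefinesWithin finiteGraphs (inducedClass pathFour) φ) ∧
    (∀ i : ℕ, 1 ≤ i → IsCograph (graphH i) ∧ ¬ SimpleGraph.IsIndContained pathFour (graphH i)) ∧
    (∃ (n : ℕ) (A : SimpleGraph (Fin n)),
      ExtensionProperty 3 A ∧ SimpleGraph.IsIndContained pathFour A) ∧
    (∀ {V : Type u} (A : SimpleGraph V),
      ExtensionProperty 3 A → SimpleGraph.IsIndContained pathFour A →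
        (∀ i : ℕ, 1 ≤ i → SimpleGraph.IsIndContained pathFour (graphG A i)) ∧
        ∀ m : ℕ, (m : ℕ∞) + 2 ≤
          logicalDepthWith 3 (graphG A (4 * m + 3)) (graphH (4 * m + 3))) := by
  refine ⟨logicalWidth_pathFour fun _ _ h => h, logicalWidth_pathFour fun _ _ _ => trivial,
    ?_, ?_, ⟨9, rookGraph, extensionProperty_rookGraph, pathFour_isIndContained_rookGraph⟩, ?_⟩
  · rintro ⟨φ, hw, hφ⟩
    have := four_le_width hφ
    omega
  · intro i hi
    obtain ⟨n, rfl⟩ := Nat.exists_eq_add_of_le' hi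
    exact ⟨isCograph_graphH n, not_pathFour_isIndContained_graphH n⟩
  · intro V A _ hA
    refine ⟨fun i _ => pathFour_isIndContained_graphG hA i, fun m => ?_⟩
    obtain ⟨f⟩ := hA
    have : Nonempty V := ⟨f 0⟩
    have hev : Even (4 * m + 2) := ⟨2 * m + 1, by ring⟩
    exact (isLevelFunction_graphG A hev).le_logicalDepthWith (isLevelFunction_graphH hev) le_rfl
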